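/- Let $(q_k)_{k\ge 1}$ be a sequence of positive integers with $q_{k+1}\ge q_k(q_k+1)$ for all $k$, and for each $k$ let $p_{0k},p_{1k}\in[0,1]$ with $p_{0k}+p_{1k}=1$. Let $\xi_1,\xi_2,\dots$ be independent random variables with $P(\xi_k=i)=p_{ik}$ for $i\in\{0,1\}$, and let $\mu$ be the distribution of $\xi=\sum_{k\ge1}(-1)^{k+1}\xi_k/q_k$, $F_\xi$ its distribution function, and $S_\mu$ its topological support. Let $\nu^*$ be the distribution of $\xi^*=\sum_{k\ge1}(-1)^{k+1}\xi^*_k/q_k$, where the $\xi_k^*$ are independent, take the values $i\in\{0,1\}$ with probabilities $p^*_{ik}$, and $p^*_{ik}=0,\,1,\,\tfrac12$ according as $p_{ik}=0$, $p_{ik}=1$, $p_{ik}\in(0,1)$. For a continuous (that is, non-atomic) probability measure $\nu$ on $\mathbb R$, a set $E\subseteq\mathbb R$ and $\alpha>0$ put $$H^\alpha(E,\nu)=\lim_{\varepsilon\to0}\ \inf\Big\{\sum_j \nu(E_j)^\alpha\Big\},$$ where the infimum is over the at most countable coverings $\{E_j\}$ of $E$ by closed intervals with $\nu(E_j)\le\varepsilon$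 for all $j$. The Hausdorff–Billingsley dimension of $E$ with respect to $\nu$ is $\dim_H(E,\nu)=\inf\{\alpha>0: H^\alpha(E,\nu)=0\}$, and that of a probability measure $\mu$ with respect to $\nu$ is $\dim_H(\mu,\nu)=\inf\{\dim_H(E,\nu): E \text{ Borel},\ \mu(E)=1\}$. The distribution function $F_\xi$ is said to preserve the Hausdorff–Billingsley dimension on $S_\mu$ if $\dim_H(E,\mu)=\dim_H(E,\nu^*)$ for every $E\subseteq S_\mu$. Let $h_k=-(p_{0k}\ln p_{0k}+p_{1k}\ln p_{1k})$ (with $0\ln 0=0$), $H_n=h_1+\dots+h_n$, and let $g_n$ be the number of positive elements among $h_1,\dots,h_n$. **Theorem.** Suppose that there is a constant $p_0>0$ with $p_{ik}>p_0$ for all $i\in\{0,1\}$ and all $k\ge1$ (so that $\mu$ and $\nu^*$ are continuous). Then $F_\xi$ preserves the Hausdorff–Billingsley dimension on $S_\mu$ if and only if $\dim_H(\mu,\nu^*)=1$. Moreover, $\dim_H(\mu,\nu^*)=1$ if and only if $$\liminf_{n\to\infty}\frac{H_n}{g_n\ln2}=1 .$$ -/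

import Mathlib

open MeasureTheory ProbabilityTheory Filter
open scoped ENNReal NNReal

noncomputable section

/-- Denominators of a second Ostrogradsky series, indexed from `0`: `q k` is the `(k+1)`-st
denominator. -/
def IsSecondOstrogradsky (q : ℕ → ℕ) : Prop :=
  (∀ k, 0 < q k) ∧ ∀ k, q k * (q k + 1) ≤ q (k + 1)

/-- The random incomplete sum `∑ (-1)^(k+1) ξ_k / q_k`, `k = 1, 2, …`, written with indices
from `0`. -/
def ostrogradskySum {Ω : Type*} (q : ℕ → ℕ) (ξ : ℕ → Ω → Fin 2) (ω : Ω) : ℝ :=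
  ∑' k : ℕ, (-1 : ℝ) ^ k * ((ξ k ω : ℕ) : ℝ) / (q k : ℝ)

/-- `ξ` is a sequence of independent random variables, `ξ k` taking the values `0` and `1` with
the probabilities `p 0 k` and `p 1 k`. -/
structure IsBernoulliSeq {Ω : Type*} [MeasurableSpace Ω] (P : Measure Ω)
    (p : Fin 2 → ℕ → ℝ) (ξ : ℕ → Ω → Fin 2) : Prop where
  measurable : ∀ k, Measurable (ξ k)
  indep : iIndepFun ξ P
  prob : ∀ i k, P {ω | ξ k ω = i} = ENNReal.ofReal (p i k)

/-- The probabilities of the uniform distribution on the spectrum: the values `0` and `1` are kept,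
and every probability strictly between them is replaced by `1 / 2`. -/
def uniformProb (p : Fin 2 → ℕ → ℝ) (i : Fin 2) (k : ℕ) : ℝ :=
  if p i k = 0 then 0 else if p i k = 1 then 1 else 1 / 2

/-- The infimum of `∑ ν(E_j)^α` over the countable coverings of `E` by closed intervals
`E_j = [c_j, d_j]` with `ν(E_j) ≤ ε`. (An interval with `d_j < c_j` is empty and contributes `0`,
so finite coverings are included.) -/
def hbPremeasure (ν : Measure ℝ) (α : ℝ≥0) (ε : ℝ≥0∞) (E : Set ℝ) : ℝ≥0∞ :=
  ⨅ (c : ℕ → ℝ) (d : ℕ → ℝ) (_ : E ⊆ ⋃ j, Set.Icc (c j) (d j))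
    (_ : ∀ j, ν (Set.Icc (c j) (d j)) ≤ ε), ∑' j, ν (Set.Icc (c j) (d j)) ^ (α : ℝ)

/-- The `ν`-`α`-Hausdorff–Billingsley measure of `E`: the limit, which is the supremum, of the
premeasures as `ε → 0`. -/
def hbMeasure (ν : Measure ℝ) (α : ℝ≥0) (E : Set ℝ) : ℝ≥0∞ :=
  ⨆ (ε : ℝ≥0∞) (_ : 0 < ε), hbPremeasure ν α ε E

/-- The Hausdorff–Billingsley dimension of the set `E` with respect to `ν`. -/
def hbDim (ν : Measure ℝ) (E : Set ℝ) : ℝ≥0∞ :=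
  ⨅ (α : ℝ≥0) (_ : 0 < α) (_ : hbMeasure ν α E = 0), (α : ℝ≥0∞)

/-- The Hausdorff–Billingsley dimension of the measure `μ` with respect to the measure `ν`. -/
def hbDimMeasure (μ ν : Measure ℝ) : ℝ≥0∞ :=
  ⨅ (E : Set ℝ) (_ : MeasurableSet E) (_ : μ E = 1), hbDim ν E

/-- The distribution function `F`, with probability measure `F.measure`, preserves the
Hausdorff–Billingsley dimension (with respect to `γ`) on the set `A`. -/
def PreservesHBDim (F : StieltjesFunction ℝ) (γ : Measure ℝ) (A : Set ℝ) : Prop :=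
  ∀ E : Set ℝ, E ⊆ A → hbDim F.measure E = hbDim γ E

/-- The entropy of the `k`-th digit. -/
def digitEntropy (p : Fin 2 → ℕ → ℝ) (k : ℕ) : ℝ :=
  -(p 0 k * Real.log (p 0 k) + p 1 k * Real.log (p 1 k))

/-- The sum `H_n` of the first `n` entropies. -/
def entropySum (p : Fin 2 → ℕ → ℝ) (n : ℕ) : ℝ :=
  ∑ k ∈ Finset.range n, digitEntropy p k

open Classical in
/-- The number `g_n` of positive elements among the first `n` entropies. -/
def positiveEntropyCount (p : Fin 2 → ℕ → ℝ) (n : ℕ) : ℕ :=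
  ((Finset.range n).filter fun k => 0 < digitEntropy p k).card

end

/-!
An Ostrogradsky series is superdecreasing: each term exceeds, in absolute value, the sum of all the
later ones. Hence the convex hulls of the cylinders of rank `n` are pairwise disjoint, and `μ` and
`ν` give to each of them the product of its digit probabilities.

*Upper bound.* By Chebyshev's inequality along the ranks `n` at which `H_n / (n log 2)` is close to
its lower limit, for `s > liminf H_n / (n log 2)` almost every point for `μ` lies in infinitely many
cylinders of `μ`-mass at least `2 ^ (-s n)`. There are at most `2 ^ (s n)` of these at rank `n`,
each of `ν`-mass `2 ^ (-n)`, so these cylinders form coverings that show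
`dim (μ, ν) ≤ liminf H_n / (n log 2)`.

*Lower limit one.* If the digit probabilities are bounded below, `|log (2 p i k)|` is controlled by
the entropy deficit `log 2 - h_k`. If the lower limit is one, then every cylinder of rank `n` has
`μ`-mass `2 ^ (-n (1 + o(1)))`, whence `μ I ≤ C (ν I) ^ s` and `ν I ≤ C (μ I) ^ s` for all intervals
`I` and `s < 1`, and all sets have the same dimension with respect to `μ` and `ν`.

*Preservation.* A set of full `μ`-measure has dimension at least one with respect to `μ`, so
`dim (μ, ν) ≥ 1` if dimensions are preserved.
-/

section IncompleteSums

/-- An absolutely convergent series each of whose terms exceeds, in absolute value, the sum of the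
absolute values of all later terms. Its incomplete sums determine their digits. -/
structure IsSuperdecreasing (a : ℕ → ℝ) : Prop where
  summable : Summable a
  tsum_abs_lt : ∀ n, ∑' j, |a (j + (n + 1))| < |a n|

/-- The random incomplete sum of the series `∑ a k` with the digits `ξ k`. -/
noncomputable def incompleteSum {Ω : Type*} (a : ℕ → ℝ) (ξ : ℕ → Ω → Fin 2) (ω : Ω) : ℝ :=
  ∑' k, a k * ((ξ k ω : ℕ) : ℝ)

/-- The convex hull of the set of incomplete sums of `∑ a k` whose first digits form the word `w`:
the extreme sums are obtained by keeping only the negative, or only the positive, later terms. -/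
noncomputable def cylinderHull (a : ℕ → ℝ) {n : ℕ} (w : Fin n → Fin 2) : Set ℝ :=
  Set.Icc (∑ k : Fin n, a k * ((w k : ℕ) : ℝ) + ∑' j, min (a (j + n)) 0)
    (∑ k : Fin n, a k * ((w k : ℕ) : ℝ) + ∑' j, max (a (j + n)) 0)

variable {Ω : Type*} {a : ℕ → ℝ} {n : ℕ}

lemma min_zero_le_mul_digit (c : ℝ) (i : Fin 2) : min c 0 ≤ c * ((i : ℕ) : ℝ) := by
  fin_cases i <;> simp

lemma mul_digit_le_max_zero (c : ℝ) (i : Fin 2) : c * ((i : ℕ) : ℝ) ≤ max c 0 := by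
  fin_cases i <;> simp

lemma summable_min_zero_nat_add (ha : Summable a) (n : ℕ) : Summable fun j => min (a (j + n)) 0 :=
  .of_norm_bounded ((summable_nat_add_iff n).mpr ha.abs) fun j => by
    simpa using abs_min_le_max_abs_abs (a := a (j + n)) (b := 0)

lemma summable_max_zero_nat_add (ha : Summable a) (n : ℕ) : Summable fun j => max (a (j + n)) 0 :=
  .of_norm_bounded ((summable_nat_add_iff n).mpr ha.abs) fun j => by
    simpa using abs_max_le_max_abs_abs (a := a (j + n)) (b := 0)

lemma incompleteSum_mem_cylinderHull (ha : Summable a) (ξ : ℕ → Ω → Fin 2) (ω : Ω) (n : ℕ) :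
    incompleteSum a ξ ω ∈ cylinderHull a fun k : Fin n => ξ k ω := by
  have hsum : Summable fun k => a k * ((ξ k ω : ℕ) : ℝ) :=
    .of_norm_bounded ha.abs fun k => by
      obtain h | h := Fin.exists_fin_two.mp ⟨ξ k ω, rfl⟩ <;> simp [h]
  have htail := (summable_nat_add_iff n).mpr hsum
  rw [cylinderHull, incompleteSum, ← hsum.sum_add_tsum_nat_add n, ← Fin.sum_univ_eq_sum_range]
  exact ⟨by gcongr; exacts [summable_min_zero_nat_add ha n, min_zero_le_mul_digit _ _],
    by gcongr; exacts [summable_max_zero_nat_add ha n, mul_digit_le_max_zero _ _]⟩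

lemma cylinderHull_subset_cylinderHull_init (ha : Summable a) (w : Fin (n + 1) → Fin 2) :
    cylinderHull a w ⊆ cylinderHull a (Fin.init w) := by
  have hmin := (summable_min_zero_nat_add ha n).sum_add_tsum_nat_add 1
  have hmax := (summable_max_zero_nat_add ha n).sum_add_tsum_nat_add 1
  simp only [Finset.sum_range_one, zero_add, add_assoc, add_comm 1 n] at hmin hmax
  have hlower := min_zero_le_mul_digit (a n) (w (Fin.last n))
  have hupper := mul_digit_le_max_zero (a n) (w (Fin.last n))
  simp only [cylinderHull, Fin.sum_univ_castSucc, Fin.val_castSucc, Fin.val_last, Fin.init]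
  exact Set.Icc_subset_Icc (by linarith) (by linarith)

lemma IsSuperdecreasing.eq_of_mem_cylinderHull (ha : IsSuperdecreasing a) {t : ℝ}
    {v w : Fin n → Fin 2} (hv : t ∈ cylinderHull a v) (hw : t ∈ cylinderHull a w) : v = w := by
  induction n with
  | zero => exact Subsingleton.elim v w
  | succ n ih =>
    have hinit : Fin.init v = Fin.init w :=
      ih (cylinderHull_subset_cylinderHull_init ha.summable v hv)
        (cylinderHull_subset_cylinderHull_init ha.summable w hw)
    have hwidth : ∑' j, max (a (j + (n + 1))) 0 - ∑' j, min (a (j + (n + 1))) 0 < |a n| := by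
      rw [← (summable_max_zero_nat_add ha.summable _).tsum_sub
        (summable_min_zero_nat_add ha.summable _)]
      simpa only [max_sub_min_eq_abs, zero_sub, abs_neg] using ha.tsum_abs_lt n
    have hprefix (k : Fin n) : v k.castSucc = w k.castSucc := congrFun hinit k
    simp only [cylinderHull, Set.mem_Icc, Fin.sum_univ_castSucc, Fin.val_castSucc, Fin.val_last,
      hprefix] at hv hw
    have hlast : v (Fin.last n) = w (Fin.last n) := by
      generalize v (Fin.last n) = i at *
      generalize w (Fin.last n) = j at *
      by_contra hne
      fin_cases i <;> fin_cases j <;> simp_all <;>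
        cases abs_cases (a n) <;> linarith
    rw [← Fin.snoc_init_self v, ← Fin.snoc_init_self w, hinit, hlast]

lemma IsSuperdecreasing.incompleteSum_mem_cylinderHull_iff (ha : IsSuperdecreasing a)
    {ξ : ℕ → Ω → Fin 2} {ω : Ω} {w : Fin n → Fin 2} :
    incompleteSum a ξ ω ∈ cylinderHull a w ↔ (fun k : Fin n => ξ k ω) = w :=
  ⟨fun h => ha.eq_of_mem_cylinderHull (incompleteSum_mem_cylinderHull ha.summable ξ ω n) h,
    fun h => h ▸ incompleteSum_mem_cylinderHull ha.summable ξ ω n⟩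

lemma ostrogradskySum_eq_incompleteSum (q : ℕ → ℕ) (ξ : ℕ → Ω → Fin 2) :
    ostrogradskySum q ξ = incompleteSum (fun k => (-1) ^ k / (q k : ℝ)) ξ := by
  funext ω
  simp only [ostrogradskySum, incompleteSum, div_mul_eq_mul_div]

lemma IsSecondOstrogradsky.three_pow_mul_le {q : ℕ → ℕ} (hq : IsSecondOstrogradsky q) (n j : ℕ) :
    3 ^ j * (2 * q n) ≤ q (j + (n + 1)) := by
  have htwo (k : ℕ) : 2 * q k ≤ q (k + 1) := by nlinarith [hq.1 k, hq.2 k]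
  induction j with
  | zero => simpa using htwo n
  | succ j ih =>
    have hstep := hq.2 (j + (n + 1))
    have hge : 2 ≤ q (j + (n + 1)) := by
      have := htwo (j + n)
      have := hq.1 (j + n)
      grind
    rw [pow_succ, show j + 1 + (n + 1) = j + (n + 1) + 1 by ring]
    nlinarith

/-- `1 / q (n + 1 + j) ≤ 1 / (2 * 3 ^ j * q n)`, and `∑ 1 / (2 * 3 ^ j) = 3 / 4 < 1`. -/
lemma IsSecondOstrogradsky.isSuperdecreasing {q : ℕ → ℕ} (hq : IsSecondOstrogradsky q) :
    IsSuperdecreasing fun k => (-1) ^ k / (q k : ℝ) := by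
  have hpos (k : ℕ) : (0 : ℝ) < q k := by exact_mod_cast hq.1 k
  have habs (k : ℕ) : |(-1) ^ k / (q k : ℝ)| = (q k : ℝ)⁻¹ := by simp [abs_div]
  have hle (n j : ℕ) : (q (j + (n + 1)) : ℝ)⁻¹ ≤ (1 / 3) ^ j * (2 * q n : ℝ)⁻¹ := by
    rw [one_div, inv_pow, ← mul_inv]
    gcongr
    · have := hpos n
      positivity
    · exact_mod_cast hq.three_pow_mul_le n j
  have hgeom (n : ℕ) :
      HasSum (fun j => (1 / 3 : ℝ) ^ j * (2 * q n : ℝ)⁻¹) (3 / 4 * (q n : ℝ)⁻¹) := by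
    have h := (hasSum_geometric_of_lt_one (r := (1 / 3 : ℝ)) (by norm_num) (by norm_num)).mul_right
      (2 * q n : ℝ)⁻¹
    rwa [show (1 - 1 / 3 : ℝ)⁻¹ * (2 * q n : ℝ)⁻¹ = 3 / 4 * (q n : ℝ)⁻¹ by rw [mul_inv]; ring] at h
  have htail (n : ℕ) : Summable fun j => (q (j + (n + 1)) : ℝ)⁻¹ :=
    .of_nonneg_of_le (fun j => by positivity) (hle n) (hgeom n).summable
  refine ⟨?_, fun n => ?_⟩
  · rw [← summable_abs_iff, ← summable_nat_add_iff 1]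
    simpa only [habs] using htail 0
  · simp only [habs]
    calc ∑' j, (q (j + (n + 1)) : ℝ)⁻¹ ≤ 3 / 4 * (q n : ℝ)⁻¹ :=
          (htail n).tsum_le_tsum (hle n) (hgeom n).summable |>.trans_eq (hgeom n).tsum_eq
      _ < (q n : ℝ)⁻¹ := by linarith [inv_pos.mpr (hpos n)]

end IncompleteSums

section Cylinders

/-- The probability that the first digits form the word `w`. -/
noncomputable def cylinderProb (p : Fin 2 → ℕ → ℝ) {n : ℕ} (w : Fin n → Fin 2) : ℝ :=
  ∏ k : Fin n, p (w k) k

variable {Ω : Type*} [MeasurableSpace Ω] {P : Measure Ω} {a : ℕ → ℝ} {p : Fin 2 → ℕ → ℝ}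
  {ξ : ℕ → Ω → Fin 2} {n : ℕ}

lemma cylinderProb_nonneg (hp : ∀ i k, 0 ≤ p i k) (w : Fin n → Fin 2) : 0 ≤ cylinderProb p w :=
  Finset.prod_nonneg fun _ _ => hp _ _

lemma cylinderProb_pos (hp : ∀ i k, 0 < p i k) (w : Fin n → Fin 2) : 0 < cylinderProb p w :=
  Finset.prod_pos fun _ _ => hp _ _

lemma log_cylinderProb (hp : ∀ i k, 0 < p i k) (w : Fin n → Fin 2) :
    Real.log (cylinderProb p w) = ∑ k : Fin n, Real.log (p (w k) k) :=
  Real.log_prod fun _ _ => (hp _ _).ne'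

lemma sum_cylinderProb (hsum : ∀ k, p 0 k + p 1 k = 1) (n : ℕ) :
    ∑ w : Fin n → Fin 2, cylinderProb p w = 1 := by
  simp only [cylinderProb, ← Fintype.prod_sum (fun (k : Fin n) i => p i k), Fin.sum_univ_two, hsum,
    Finset.prod_const_one]

lemma IsBernoulliSeq.isProbabilityMeasure (hξ : IsBernoulliSeq P p ξ) : IsProbabilityMeasure P :=
  hξ.indep.isProbabilityMeasure

lemma IsBernoulliSeq.measure_prefix_eq (hξ : IsBernoulliSeq P p ξ) (hp : ∀ i k, 0 ≤ p i k)
    (w : Fin n → Fin 2) :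
    P {ω | (fun k : Fin n => ξ k ω) = w} = ENNReal.ofReal (cylinderProb p w) := by
  have h := (hξ.indep.precomp Fin.val_injective).measure_inter_preimage_eq_mul Finset.univ
    (sets := fun k => {w k}) fun k _ => measurableSet_singleton _
  rw [cylinderProb, ENNReal.ofReal_prod_of_nonneg fun k _ => hp _ _]
  convert h using 2 with k
  · ext ω
    simp [funext_iff]
  · exact (hξ.prob (w k) k).symm

lemma IsBernoulliSeq.measurable_incompleteSum (hξ : IsBernoulliSeq P p ξ) (a : ℕ → ℝ) :
    Measurable (incompleteSum a ξ) :=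
  .tsum fun k => ((measurable_of_finite fun i : Fin 2 => ((i : ℕ) : ℝ)).comp
    (hξ.measurable k)).const_mul _

lemma IsBernoulliSeq.isProbabilityMeasure_map (hξ : IsBernoulliSeq P p ξ) (a : ℕ → ℝ) :
    IsProbabilityMeasure (P.map (incompleteSum a ξ)) :=
  have := hξ.isProbabilityMeasure
  Measure.isProbabilityMeasure_map (hξ.measurable_incompleteSum a).aemeasurable

lemma IsBernoulliSeq.map_cylinderHull (hξ : IsBernoulliSeq P p ξ) (ha : IsSuperdecreasing a)
    (hp : ∀ i k, 0 ≤ p i k) (w : Fin n → Fin 2) :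
    P.map (incompleteSum a ξ) (cylinderHull a w) = ENNReal.ofReal (cylinderProb p w) := by
  rw [cylinderHull, Measure.map_apply (hξ.measurable_incompleteSum a) measurableSet_Icc,
    ← cylinderHull, ← hξ.measure_prefix_eq hp w]
  exact congrArg P (Set.ext fun ω => ha.incompleteSum_mem_cylinderHull_iff)

lemma endpoint_mem_of_not_subset_Icc {s : Set ℝ} (hs : s.OrdConnected) {c d t : ℝ} (ht : t ∈ s)
    (htI : t ∈ Set.Icc c d) (h : ¬ s ⊆ Set.Icc c d) : c ∈ s ∨ d ∈ s := by
  obtain ⟨u, hu, huI⟩ := Set.not_subset.mp h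
  obtain huc | hcu := lt_or_ge u c
  · exact .inl (hs.out hu ht ⟨huc.le, htI.1⟩)
  · exact .inr (hs.out ht hu ⟨htI.2, le_of_not_ge fun hud => huI ⟨hcu, hud⟩⟩)

/-- Every cylinder hull of rank `n` that meets `[c, d]` contains `c` or `d`, and for each of the
two points there is at most one such hull. -/
lemma IsBernoulliSeq.map_Icc_le (hξ : IsBernoulliSeq P p ξ) (ha : IsSuperdecreasing a)
    (hp : ∀ i k, 0 ≤ p i k) {c d : ℝ}
    (hcd : ∀ w : Fin n → Fin 2, ¬ cylinderHull a w ⊆ Set.Icc c d) {M : ℝ≥0∞}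
    (hM : ∀ w : Fin n → Fin 2, ENNReal.ofReal (cylinderProb p w) ≤ M) :
    P.map (incompleteSum a ξ) (Set.Icc c d) ≤ 2 * M := by
  have hpoint (t : ℝ) : P {ω | t ∈ cylinderHull a fun k : Fin n => ξ k ω} ≤ M := by
    obtain hempty | ⟨ω₀, hω₀⟩ :=
      Set.eq_empty_or_nonempty {ω | t ∈ cylinderHull a fun k : Fin n => ξ k ω}
    · simp [hempty]
    · calc _ ≤ P {ω | (fun k : Fin n => ξ k ω) = fun k : Fin n => ξ k ω₀} :=
            measure_mono fun ω hω => ha.eq_of_mem_cylinderHull hω hω₀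
        _ ≤ M := (hξ.measure_prefix_eq hp _).trans_le (hM _)
  rw [Measure.map_apply (hξ.measurable_incompleteSum a) measurableSet_Icc, two_mul]
  refine (measure_mono fun ω hω => ?_).trans
    ((measure_union_le _ _).trans (add_le_add (hpoint c) (hpoint d)))
  exact endpoint_mem_of_not_subset_Icc Set.ordConnected_Icc
    (incompleteSum_mem_cylinderHull ha.summable ξ ω n) hω (hcd _)

lemma IsBernoulliSeq.map_Icc_eq_zero (hξ : IsBernoulliSeq P p ξ) (ha : IsSuperdecreasing a)
    (hp : ∀ i k, 0 ≤ p i k) (hvanish : ∀ ε > 0, ∃ n, ∀ w : Fin n → Fin 2, cylinderProb p w ≤ ε)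
    {c d : ℝ} (hcd : ∀ n (w : Fin n → Fin 2), ¬ cylinderHull a w ⊆ Set.Icc c d) :
    P.map (incompleteSum a ξ) (Set.Icc c d) = 0 := by
  refine le_antisymm (ENNReal.le_of_forall_pos_le_add fun ε hε _ => ?_) zero_le
  obtain ⟨n, hn⟩ := hvanish (ε / 2) (by positivity)
  refine (hξ.map_Icc_le ha hp (hcd n) fun w => ENNReal.ofReal_le_ofReal (hn w)).trans_eq ?_
  rw [zero_add, ENNReal.ofReal_div_of_pos two_pos, ENNReal.ofReal_ofNat, ENNReal.ofReal_coe_nnreal,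
    ENNReal.mul_div_cancel two_ne_zero (by simp)]

/-- Apply the comparison of cylinders at the least rank `n + 1` at which `[c, d]` contains a whole
cylinder hull `w`: then `μ [c, d]` is at most twice the largest mass of a cylinder of rank `n`, and
`ν [c, d]` is at least the mass of `w`. -/
lemma IsBernoulliSeq.map_Icc_le_mul_rpow {Ω' : Type*} [MeasurableSpace Ω'] {P' : Measure Ω'}
    {p' : Fin 2 → ℕ → ℝ} {ξ' : ℕ → Ω' → Fin 2} (hξ : IsBernoulliSeq P p ξ)
    (hξ' : IsBernoulliSeq P' p' ξ') (ha : IsSuperdecreasing a) (hp : ∀ i k, 0 ≤ p i k)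
    (hp' : ∀ i k, 0 ≤ p' i k) (hvanish : ∀ ε > 0, ∃ n, ∀ w : Fin n → Fin 2, cylinderProb p w ≤ ε)
    {s C : ℝ≥0} (hcomp : ∀ n (v : Fin n → Fin 2) (w : Fin (n + 1) → Fin 2),
      cylinderProb p v ≤ C * cylinderProb p' w ^ (s : ℝ)) (c d : ℝ) :
    P.map (incompleteSum a ξ) (Set.Icc c d) ≤
      (2 * C + 1 : ℝ≥0) * P'.map (incompleteSum a ξ') (Set.Icc c d) ^ (s : ℝ) := by
  have := hξ.isProbabilityMeasure_map a
  by_cases hex : ∃ n, ∃ w : Fin n → Fin 2, cylinderHull a w ⊆ Set.Icc c d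
  swap
  · push Not at hex
    simp [hξ.map_Icc_eq_zero ha hp hvanish hex]
  classical
  obtain ⟨w, hw⟩ := Nat.find_spec hex
  have hmin (m : ℕ) (hm : m < Nat.find hex) := not_exists.mp (Nat.find_min hex hm)
  generalize Nat.find hex = n at w hw hmin
  have hlower := (hξ'.map_cylinderHull ha hp' w).symm.trans_le (measure_mono hw)
  cases n with
  | zero =>
    have hone : 1 ≤ P'.map (incompleteSum a ξ') (Set.Icc c d) := by
      simpa [cylinderProb] using hlower
    calc P.map (incompleteSum a ξ) (Set.Icc c d) ≤ 1 * 1 ^ (s : ℝ) := by simpa using prob_le_one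
      _ ≤ _ := by gcongr; simp
  | succ n =>
    have hupper (v : Fin n → Fin 2) : ENNReal.ofReal (cylinderProb p v) ≤
        C * P'.map (incompleteSum a ξ') (Set.Icc c d) ^ (s : ℝ) := by
      refine (ENNReal.ofReal_le_ofReal (hcomp n v w)).trans ?_
      rw [ENNReal.ofReal_mul C.coe_nonneg, ENNReal.ofReal_coe_nnreal,
        ← ENNReal.ofReal_rpow_of_nonneg (cylinderProb_nonneg hp' w) s.coe_nonneg]
      gcongr
    calc P.map (incompleteSum a ξ) (Set.Icc c d)
        ≤ 2 * (C * P'.map (incompleteSum a ξ') (Set.Icc c d) ^ (s : ℝ)) :=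
          hξ.map_Icc_le ha hp (hmin n n.lt_succ_self) hupper
      _ ≤ _ := by
          rw [← mul_assoc]
          gcongr
          push_cast
          exact le_self_add

end Cylinders

section HausdorffBillingsley

variable {μ ν : Measure ℝ} {α s : ℝ≥0} {E E' : Set ℝ}

/-- The condition `ν (E_j) ≤ ε` on coverings may be dropped here, since it is implied by
`∑ ν (E_j) ^ α ≤ ε ^ α`. -/
lemma hbMeasure_eq_zero_iff (hα : 0 < α) :
    hbMeasure ν α E = 0 ↔ ∀ η : ℝ≥0∞, 0 < η → ∃ c d : ℕ → ℝ,
      E ⊆ ⋃ j, Set.Icc (c j) (d j) ∧ ∑' j, ν (Set.Icc (c j) (d j)) ^ (α : ℝ) ≤ η := by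
  have hα' : (0 : ℝ) < α := hα
  simp only [hbMeasure, ENNReal.iSup_eq_zero]
  refine ⟨fun h η hη => ?_, fun h ε hε => ?_⟩
  · have hlt : hbPremeasure ν α 1 E < η := (h 1 one_pos).trans_lt hη
    simp only [hbPremeasure, iInf_lt_iff] at hlt
    obtain ⟨c, d, hcover, -, hlt⟩ := hlt
    exact ⟨c, d, hcover, hlt.le⟩
  · refine le_antisymm (le_of_forall_pos_le_add fun η hη => ?_) zero_le
    rw [zero_add]
    have hε' : 0 < ε ^ (α : ℝ) := ENNReal.rpow_pos_of_nonneg hε hα'.le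
    obtain ⟨c, d, hcover, hsum⟩ := h (min η (ε ^ (α : ℝ))) (lt_min hη hε')
    have hsmall (j : ℕ) : ν (Set.Icc (c j) (d j)) ≤ ε :=
      (ENNReal.rpow_le_rpow_iff hα').mp
        ((ENNReal.le_tsum j).trans (hsum.trans (min_le_right _ _)))
    exact iInf₂_le_of_le c d (iInf₂_le_of_le hcover hsmall (hsum.trans (min_le_left _ _)))

lemma hbDim_mono (ν : Measure ℝ) (h : E ⊆ E') : hbDim ν E ≤ hbDim ν E' := by
  refine le_iInf₂ fun α hα => le_iInf fun hzero => iInf₂_le_of_le α hα (iInf_le _ ?_)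
  rw [hbMeasure_eq_zero_iff hα] at hzero ⊢
  intro η hη
  obtain ⟨c, d, hcover, hsum⟩ := hzero η hη
  exact ⟨c, d, h.trans hcover, hsum⟩

lemma hbDim_le_of_hbMeasure_eq_zero (hα : 0 < α) (h : hbMeasure ν α E = 0) : hbDim ν E ≤ α :=
  iInf₂_le_of_le α hα (iInf_le _ h)

lemma one_le_hbDim_self [IsProbabilityMeasure μ] (hE : μ E = 1) : 1 ≤ hbDim μ E := by
  refine le_iInf₂ fun α hα => le_iInf fun hzero => ?_
  by_contra! hlt
  have hα1 : (α : ℝ) ≤ 1 := mod_cast hlt.le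
  obtain ⟨c, d, hcover, hsum⟩ := (hbMeasure_eq_zero_iff hα).mp hzero 2⁻¹ (by simp)
  have : (1 : ℝ≥0∞) ≤ 2⁻¹ :=
    calc (1 : ℝ≥0∞) = μ E := hE.symm
      _ ≤ ∑' j, μ (Set.Icc (c j) (d j)) := (measure_mono hcover).trans (measure_iUnion_le _)
      _ ≤ ∑' j, μ (Set.Icc (c j) (d j)) ^ (α : ℝ) :=
        ENNReal.tsum_le_tsum fun j => by
          simpa using ENNReal.rpow_le_rpow_of_exponent_ge (prob_le_one (μ := μ)) hα1
      _ ≤ 2⁻¹ := hsum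
  exact this.not_gt (by simp)

lemma hbMeasure_div_eq_zero_of_Icc_le {C : ℝ≥0} (hs : 0 < s)
    (h : ∀ c d, μ (Set.Icc c d) ≤ C * ν (Set.Icc c d) ^ (s : ℝ)) (hα : 0 < α)
    (hzero : hbMeasure ν α E = 0) : hbMeasure μ (α / s) E = 0 := by
  rw [hbMeasure_eq_zero_iff (div_pos hα hs)]
  rw [hbMeasure_eq_zero_iff hα] at hzero
  intro η hη
  set K : ℝ≥0∞ := (C : ℝ≥0∞) ^ ((α / s : ℝ≥0) : ℝ) + 1
  have hK : K ≠ ⊤ := by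
    simpa [K] using ENNReal.rpow_ne_top_of_nonneg (by positivity) ENNReal.coe_ne_top
  obtain ⟨c, d, hcover, hsum⟩ := hzero (η / K) (ENNReal.div_pos hη.ne' hK)
  have hterm (j : ℕ) : μ (Set.Icc (c j) (d j)) ^ ((α / s : ℝ≥0) : ℝ) ≤
      K * ν (Set.Icc (c j) (d j)) ^ (α : ℝ) :=
    calc _ ≤ (C * ν (Set.Icc (c j) (d j)) ^ (s : ℝ)) ^ ((α / s : ℝ≥0) : ℝ) := by gcongr; exact h _ _
      _ = (C : ℝ≥0∞) ^ ((α / s : ℝ≥0) : ℝ) * ν (Set.Icc (c j) (d j)) ^ (α : ℝ) := by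
        rw [ENNReal.mul_rpow_of_nonneg _ _ (by positivity), ← ENNReal.rpow_mul, NNReal.coe_div,
          mul_div_cancel₀ _ (NNReal.coe_ne_zero.mpr hs.ne')]
      _ ≤ _ := by gcongr; exact le_self_add
  refine ⟨c, d, hcover, ?_⟩
  calc _ ≤ ∑' j, K * ν (Set.Icc (c j) (d j)) ^ (α : ℝ) := ENNReal.tsum_le_tsum hterm
    _ = K * ∑' j, ν (Set.Icc (c j) (d j)) ^ (α : ℝ) := ENNReal.tsum_mul_left
    _ ≤ K * (η / K) := by gcongr
    _ ≤ η := ENNReal.mul_div_le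

lemma hbDim_le_hbDim_of_Icc_le
    (h : ∀ s : ℝ≥0, 0 < s → s < 1 →
      ∃ C : ℝ≥0, ∀ c d, μ (Set.Icc c d) ≤ C * ν (Set.Icc c d) ^ (s : ℝ)) (E : Set ℝ) :
    hbDim μ E ≤ hbDim ν E := by
  refine le_iInf₂ fun α hα => le_iInf fun hzero => ENNReal.le_of_forall_pos_le_add fun ε hε _ => ?_
  have hlt : α / (α + ε) < 1 := (div_lt_one (by positivity)).mpr (lt_add_of_pos_right _ hε)
  obtain ⟨C, hC⟩ := h (α / (α + ε)) (by positivity) hlt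
  calc hbDim μ E ≤ (α / (α / (α + ε)) : ℝ≥0) := hbDim_le_of_hbMeasure_eq_zero (by positivity)
        (hbMeasure_div_eq_zero_of_Icc_le (by positivity) hC hα hzero)
    _ = α + ε := by rw [div_div_cancel₀ hα.ne', ENNReal.coe_add]

lemma exists_nat_Icc_cover {ι : Type*} [Countable ι] (c d : ι → ℝ) {f : Set ℝ → ℝ≥0∞}
    (hf : f ∅ = 0) : ∃ c' d' : ℕ → ℝ, ⋃ i, Set.Icc (c i) (d i) ⊆ ⋃ j, Set.Icc (c' j) (d' j) ∧
      ∑' j, f (Set.Icc (c' j) (d' j)) = ∑' i, f (Set.Icc (c i) (d i)) := by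
  obtain ⟨e, he⟩ := exists_injective_nat ι
  refine ⟨Function.extend e c 1, Function.extend e d 0, Set.iUnion_subset fun i => ?_, ?_⟩
  · refine subset_of_eq_of_subset ?_ (Set.subset_iUnion _ (e i))
    rw [he.extend_apply, he.extend_apply]
  · rw [← he.tsum_eq]
    · simp only [he.extend_apply]
    · refine Function.support_subset_iff'.mpr fun j hj => ?_
      simp [Function.extend_apply' _ _ _ hj, hf]

lemma hbMeasure_setOf_frequently_mem_Icc {ι : Type*} [Countable ι] {c d : ι → ℝ} (hα : 0 < α)
    (h : ∑' i, ν (Set.Icc (c i) (d i)) ^ (α : ℝ) ≠ ⊤) :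
    hbMeasure ν α {t | ∃ᶠ i in cofinite, t ∈ Set.Icc (c i) (d i)} = 0 := by
  refine (hbMeasure_eq_zero_iff hα).mpr fun η hη => ?_
  obtain ⟨s, hs⟩ := ((ENNReal.tendsto_tsum_compl_atTop_zero h).eventually_le_const hη).exists
  obtain ⟨c', d', hcover, hsum⟩ := exists_nat_Icc_cover (fun i : {i // i ∉ s} => c i) (fun i => d i)
    (f := fun I => ν I ^ (α : ℝ)) (by simpa using hα)
  refine ⟨c', d', fun t ht => hcover ?_, hsum.trans_le hs⟩
  obtain ⟨i, hi, his⟩ := (ht.and_eventually s.finite_toSet.eventually_cofinite_notMem).exists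
  exact Set.mem_iUnion.mpr ⟨⟨i, his⟩, hi⟩

lemma hbDimMeasure_le_hbDim [IsProbabilityMeasure μ] (ν : Measure ℝ) (h : ∀ᵐ t ∂μ, t ∈ E) :
    hbDimMeasure μ ν ≤ hbDim ν E := by
  have hmeas := (measurableSet_toMeasurable μ Eᶜ).compl
  have hfull : μ (toMeasurable μ Eᶜ)ᶜ = 1 := by
    rw [prob_compl_eq_one_iff (measurableSet_toMeasurable μ Eᶜ), measure_toMeasurable]
    exact h
  exact (iInf₂_le_of_le _ hmeas (iInf_le _ hfull)).trans
    (hbDim_mono ν (Set.compl_subset_comm.mp (subset_toMeasurable μ Eᶜ)))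

lemma one_le_hbDimMeasure_of_preservesHBDim [IsProbabilityMeasure μ]
    (h : PreservesHBDim (cdf μ) ν μ.support) : 1 ≤ hbDimMeasure μ ν := by
  refine le_iInf₂ fun E _ => le_iInf fun hE => ?_
  have hfull : μ (E ∩ μ.support) = 1 := by
    rw [measure_inter_conull Measure.measure_compl_support, hE]
  calc 1 ≤ hbDim μ (E ∩ μ.support) := one_le_hbDim_self hfull
    _ = hbDim ν (E ∩ μ.support) := by rw [← h _ Set.inter_subset_right, measure_cdf]
    _ ≤ hbDim ν E := hbDim_mono ν Set.inter_subset_left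

end HausdorffBillingsley

section Entropy

/-- The entropy of the first `n` digits relative to its largest possible value `n * log 2`. -/
noncomputable def entropyRatio (p : Fin 2 → ℕ → ℝ) (n : ℕ) : ℝ :=
  entropySum p n / (n * Real.log 2)

/-- The digit probabilities `p` are asymptotically uniform if the cylinders of rank `n` have
probabilities `2 ^ (-n * (1 + o(1)))`, uniformly over the cylinders. The constant `A` makes the
estimate valid for all `n`. -/
def IsAsymptoticallyUniform (p : Fin 2 → ℕ → ℝ) : Prop :=
  ∀ δ > 0, ∃ A, ∀ n (w : Fin n → Fin 2),
    |Real.log (cylinderProb p w) + n * Real.log 2| ≤ A + δ * n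

variable {p p' : Fin 2 → ℕ → ℝ}

lemma digitEntropy_eq_binEntropy {k : ℕ} (h : p 0 k + p 1 k = 1) (i : Fin 2) :
    digitEntropy p k = Real.binEntropy (p i k) := by
  have h1 : p 1 k = 1 - p 0 k := eq_sub_of_add_eq' h
  have h0 : digitEntropy p k = Real.binEntropy (p 0 k) := by
    rw [digitEntropy, Real.binEntropy_eq_negMulLog_add_negMulLog_one_sub, ← h1]
    simp only [Real.negMulLog]
    ring
  match i with
  | 0 => exact h0
  | 1 => rw [h0, h1, Real.binEntropy_one_sub]

lemma digitEntropy_le_log_two (hsum : ∀ k, p 0 k + p 1 k = 1) (k : ℕ) :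
    digitEntropy p k ≤ Real.log 2 :=
  (digitEntropy_eq_binEntropy (hsum k) 0).trans_le Real.binEntropy_le_log_two

lemma digitEntropy_pos (hsum : ∀ k, p 0 k + p 1 k = 1) (hp : ∀ i k, 0 < p i k) (k : ℕ) :
    0 < digitEntropy p k := by
  rw [digitEntropy_eq_binEntropy (hsum k) 0]
  exact Real.binEntropy_pos (hp 0 k) (by linarith [hp 1 k, hsum k])

lemma entropySum_le (hsum : ∀ k, p 0 k + p 1 k = 1) (n : ℕ) :
    entropySum p n ≤ n * Real.log 2 := by
  simpa [entropySum] using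
    Finset.sum_le_card_nsmul (Finset.range n) _ _ fun k _ => digitEntropy_le_log_two hsum k

lemma entropyRatio_nonneg (hsum : ∀ k, p 0 k + p 1 k = 1) (hp : ∀ i k, 0 < p i k) (n : ℕ) :
    0 ≤ entropyRatio p n :=
  div_nonneg (Finset.sum_nonneg fun k _ => (digitEntropy_pos hsum hp k).le) (by positivity)

lemma entropyRatio_le_one (hsum : ∀ k, p 0 k + p 1 k = 1) (n : ℕ) : entropyRatio p n ≤ 1 :=
  div_le_one_of_le₀ (entropySum_le hsum n) (by positivity)

lemma entropyRatio_mul (p : Fin 2 → ℕ → ℝ) (n : ℕ) :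
    entropyRatio p n * (n * Real.log 2) = entropySum p n := by
  obtain rfl | hn := eq_or_ne n 0
  · simp [entropySum]
  · exact div_mul_cancel₀ _ (by positivity)

lemma positiveEntropyCount_eq (h : ∀ k, 0 < digitEntropy p k) (n : ℕ) :
    positiveEntropyCount p n = n := by
  simp [positiveEntropyCount, h]

lemma uniformProb_eq_half (hsum : ∀ k, p 0 k + p 1 k = 1) (hp : ∀ i k, 0 < p i k) (i : Fin 2)
    (k : ℕ) : uniformProb p i k = 1 / 2 := by
  have hne : p i k ≠ 1 := by
    have h0 := hp 0 k
    have h1 := hp 1 k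
    have h := hsum k
    fin_cases i <;> simp only [Fin.zero_eta, Fin.mk_one] <;> linarith
  rw [uniformProb, if_neg (hp i k).ne', if_neg hne]

lemma isBoundedUnder_ge_entropyRatio (hsum : ∀ k, p 0 k + p 1 k = 1) (hp : ∀ i k, 0 < p i k) :
    IsBoundedUnder (· ≥ ·) atTop (entropyRatio p) :=
  isBoundedUnder_of ⟨0, entropyRatio_nonneg hsum hp⟩

lemma liminf_entropyRatio_le_one (hsum : ∀ k, p 0 k + p 1 k = 1) (hp : ∀ i k, 0 < p i k) :
    liminf (entropyRatio p) atTop ≤ 1 :=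
  liminf_le_of_frequently_le (.of_forall (entropyRatio_le_one hsum))
    (isBoundedUnder_ge_entropyRatio hsum hp)

lemma tendsto_entropyRatio_of_liminf_eq_one (hsum : ∀ k, p 0 k + p 1 k = 1)
    (hp : ∀ i k, 0 < p i k) (h : liminf (entropyRatio p) atTop = 1) :
    Tendsto (entropyRatio p) atTop (nhds 1) := by
  have hbdd : IsBoundedUnder (· ≤ ·) atTop (entropyRatio p) :=
    isBoundedUnder_of ⟨1, entropyRatio_le_one hsum⟩
  have hbdd' := isBoundedUnder_ge_entropyRatio hsum hp
  exact tendsto_of_le_liminf_of_limsup_le h.ge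
    (limsup_le_of_le hbdd'.isCoboundedUnder_le (.of_forall (entropyRatio_le_one hsum))) hbdd hbdd'

lemma exists_le_add_mul_of_isCompact {X : Type*} [TopologicalSpace X] [T2Space X] {K : Set X}
    (hK : IsCompact K) {f g : X → ℝ} (hf : ContinuousOn f K) (hg : ContinuousOn g K)
    (hg0 : ∀ x ∈ K, 0 ≤ g x) (hfg : ∀ x ∈ K, g x = 0 → f x ≤ 0) {δ : ℝ} (hδ : 0 < δ) :
    ∃ C, ∀ x ∈ K, f x ≤ δ + C * g x := by
  have hL : IsCompact (K ∩ f ⁻¹' Set.Ici δ) :=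
    hK.of_isClosed_subset (hf.preimage_isClosed_of_isClosed hK.isClosed isClosed_Ici)
      Set.inter_subset_left
  have hgpos (x : X) (hx : x ∈ K ∩ f ⁻¹' Set.Ici δ) : 0 < g x :=
    (hg0 x hx.1).lt_of_ne' fun hzero => (hδ.trans_le hx.2).not_ge (hfg x hx.1 hzero)
  have hquot : ContinuousOn (fun x => f x / g x) (K ∩ f ⁻¹' Set.Ici δ) :=
    (hf.mono Set.inter_subset_left).div (hg.mono Set.inter_subset_left) fun x hx => (hgpos x hx).ne'
  obtain ⟨C, hC⟩ := hL.bddAbove_image hquot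
  refine ⟨max C 0, fun x hx => ?_⟩
  obtain hlt | hge := lt_or_ge (f x) δ
  · nlinarith [hg0 x hx, le_max_right C 0]
  · have hle : f x / g x ≤ max C 0 := (hC ⟨x, ⟨hx, hge⟩, rfl⟩).trans (le_max_left _ _)
    linarith [(div_le_iff₀ (hgpos x ⟨hx, hge⟩)).mp hle]

/-- The entropy deficit `log 2 - h_k` vanishes only for the uniform distribution, for which
`log (2 * p i k) = 0`; now use compactness of the set of probabilities that are at least `p₀`. -/
lemma exists_abs_log_two_mul_le (hsum : ∀ k, p 0 k + p 1 k = 1) {p₀ : ℝ} (hp₀ : 0 < p₀)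
    (hp : ∀ i k, p₀ ≤ p i k) {δ : ℝ} (hδ : 0 < δ) :
    ∃ C, ∀ i k, |Real.log (2 * p i k)| ≤ δ + C * (Real.log 2 - digitEntropy p k) := by
  have hne (x : ℝ) (hx : x ∈ Set.Icc p₀ 1) : 2 * x ≠ 0 := by linarith [hx.1]
  obtain ⟨C, hC⟩ := exists_le_add_mul_of_isCompact (K := Set.Icc p₀ 1) isCompact_Icc
    (f := fun x => |Real.log (2 * x)|) (g := fun x => Real.log 2 - Real.binEntropy x)
    ((continuousOn_const.mul continuousOn_id).log hne).abs (by fun_prop)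
    (fun x _ => sub_nonneg.mpr Real.binEntropy_le_log_two)
    (fun x _ hx => by simp [Real.binEntropy_eq_log_two.mp (sub_eq_zero.mp hx).symm]) hδ
  refine ⟨C, fun i k => ?_⟩
  rw [digitEntropy_eq_binEntropy (hsum k) i]
  refine hC _ ⟨hp i k, ?_⟩
  have h0 := hp 0 k
  have h1 := hp 1 k
  have h := hsum k
  fin_cases i <;> simp only [Fin.zero_eta, Fin.mk_one] <;> linarith

lemma isAsymptoticallyUniform_of_tendsto (hsum : ∀ k, p 0 k + p 1 k = 1) {p₀ : ℝ} (hp₀ : 0 < p₀)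
    (hp : ∀ i k, p₀ ≤ p i k) (h : Tendsto (entropyRatio p) atTop (nhds 1)) :
    IsAsymptoticallyUniform p := by
  intro δ hδ
  obtain ⟨C, hC⟩ := exists_abs_log_two_mul_le hsum hp₀ hp (half_pos hδ)
  have hdeficit : ∃ A, ∀ n : ℕ, C * (n * Real.log 2 - entropySum p n) ≤ A + δ / 2 * n := by
    have hlim : Tendsto (fun n => C * ((1 - entropyRatio p n) * Real.log 2)) atTop (nhds 0) := by
      simpa using ((h.const_sub 1).mul_const (Real.log 2)).const_mul C
    have hbdd : IsBoundedUnder (· ≤ ·) atTop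
        fun n : ℕ => C * (n * Real.log 2 - entropySum p n) - δ / 2 * n := by
      refine isBoundedUnder_of_eventually_le (a := 0) ?_
      filter_upwards [hlim.eventually_le_const (half_pos hδ)] with n hn
      rw [← entropyRatio_mul]
      linarith [mul_le_mul_of_nonneg_left hn (Nat.cast_nonneg (α := ℝ) n)]
    obtain ⟨A, hA⟩ := hbdd.bddAbove_range
    exact ⟨A, fun n => by linarith [hA ⟨n, rfl⟩]⟩
  obtain ⟨A, hA⟩ := hdeficit
  refine ⟨A, fun n w => ?_⟩
  have hpos (i : Fin 2) (k : ℕ) : 0 < p i k := hp₀.trans_le (hp i k)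
  calc |Real.log (cylinderProb p w) + n * Real.log 2|
      = |∑ k : Fin n, Real.log (2 * p (w k) k)| := by
        simp [log_cylinderProb hpos, Real.log_mul two_ne_zero (hpos _ _).ne',
          Finset.sum_add_distrib, add_comm]
    _ ≤ ∑ k : Fin n, (δ / 2 + C * (Real.log 2 - digitEntropy p k)) :=
        (Finset.abs_sum_le_sum_abs _ _).trans (Finset.sum_le_sum fun k _ => hC (w k) k)
    _ = δ / 2 * n + C * (n * Real.log 2 - entropySum p n) := by
        rw [Finset.sum_add_distrib, ← Finset.mul_sum, Finset.sum_sub_distrib,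
          Fin.sum_univ_eq_sum_range (digitEntropy p), ← entropySum]
        simp [mul_comm]
    _ ≤ A + δ * n := by linarith [hA n]

lemma isAsymptoticallyUniform_of_eq_half (hp : ∀ i k, p i k = 1 / 2) :
    IsAsymptoticallyUniform p :=
  fun δ hδ => ⟨0, fun n w => by
    simpa [log_cylinderProb (p := p) (by simp [hp]), hp] using by positivity⟩

lemma IsAsymptoticallyUniform.exists_cylinderProb_le (hu : IsAsymptoticallyUniform p)
    (hp : ∀ i k, 0 < p i k) {ε : ℝ} (hε : 0 < ε) :
    ∃ n, ∀ w : Fin n → Fin 2, cylinderProb p w ≤ ε := by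
  have hlog : 0 < Real.log 2 := Real.log_pos one_lt_two
  obtain ⟨A, hA⟩ := hu (Real.log 2 / 2) (half_pos hlog)
  obtain ⟨n, hn⟩ := exists_nat_ge ((A - Real.log ε) / (Real.log 2 / 2))
  refine ⟨n, fun w => (Real.log_le_log_iff (cylinderProb_pos hp w) hε).mp ?_⟩
  linarith [(div_le_iff₀ (half_pos hlog)).mp hn, (abs_le.mp (hA n w)).2]

lemma IsAsymptoticallyUniform.exists_cylinderProb_le_mul_rpow (hu : IsAsymptoticallyUniform p)
    (hu' : IsAsymptoticallyUniform p') (hp : ∀ i k, 0 < p i k) (hp' : ∀ i k, 0 < p' i k) {s : ℝ≥0}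
    (hs : s < 1) : ∃ C : ℝ≥0, ∀ n (v : Fin n → Fin 2) (w : Fin (n + 1) → Fin 2),
      cylinderProb p v ≤ C * cylinderProb p' w ^ (s : ℝ) := by
  have hs1 : 0 < 1 - (s : ℝ) := sub_pos.mpr (mod_cast hs)
  set δ := (1 - (s : ℝ)) * Real.log 2 / 2
  have hδ : 0 < δ := by positivity
  obtain ⟨A, hA⟩ := hu δ hδ
  obtain ⟨A', hA'⟩ := hu' δ hδ
  set B := A + s * (Real.log 2 + A' + δ)
  refine ⟨(Real.exp B).toNNReal, fun n v w => ?_⟩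
  have hw := cylinderProb_pos hp' w
  rw [Real.coe_toNNReal _ (Real.exp_nonneg B),
    ← Real.log_le_log_iff (cylinderProb_pos hp v) (by positivity)]
  have hlower := mul_le_mul_of_nonneg_left (abs_le.mp (hA' (n + 1) w)).1 s.coe_nonneg
  push_cast at hlower
  have hslack : (1 + s) * δ ≤ (1 - s) * Real.log 2 :=
    calc (1 + s) * δ ≤ 2 * δ := by gcongr; linarith
      _ = (1 - s) * Real.log 2 := mul_div_cancel₀ _ two_ne_zero
  calc Real.log (cylinderProb p v) ≤ A + δ * n - n * Real.log 2 := by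
        linarith [(abs_le.mp (hA n v)).2]
    _ ≤ A - s * (δ * n) - s * (n * Real.log 2) := by
        linarith [mul_le_mul_of_nonneg_right hslack (Nat.cast_nonneg (α := ℝ) n)]
    _ ≤ B + s * Real.log (cylinderProb p' w) := by linarith
    _ = Real.log (Real.exp B * cylinderProb p' w ^ (s : ℝ)) := by
        rw [Real.log_mul (Real.exp_ne_zero B) (by positivity), Real.log_exp, Real.log_rpow hw]

variable {Ω Ω' : Type*} [MeasurableSpace Ω] [MeasurableSpace Ω'] {P : Measure Ω} {P' : Measure Ω'}
  {a : ℕ → ℝ} {ξ : ℕ → Ω → Fin 2} {ξ' : ℕ → Ω' → Fin 2}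

lemma IsBernoulliSeq.hbDim_map_le (hξ : IsBernoulliSeq P p ξ) (hξ' : IsBernoulliSeq P' p' ξ')
    (ha : IsSuperdecreasing a) (hp : ∀ i k, 0 < p i k) (hp' : ∀ i k, 0 < p' i k)
    (hu : IsAsymptoticallyUniform p) (hu' : IsAsymptoticallyUniform p') (E : Set ℝ) :
    hbDim (P.map (incompleteSum a ξ)) E ≤ hbDim (P'.map (incompleteSum a ξ')) E :=
  hbDim_le_hbDim_of_Icc_le (fun _ _ hs => by
    obtain ⟨C, hC⟩ := hu.exists_cylinderProb_le_mul_rpow hu' hp hp' hs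
    exact ⟨2 * C + 1, hξ.map_Icc_le_mul_rpow hξ' ha (fun i k => (hp i k).le)
      (fun i k => (hp' i k).le) (fun _ hε => hu.exists_cylinderProb_le hp hε) hC⟩) E

lemma IsBernoulliSeq.preservesHBDim (hξ : IsBernoulliSeq P p ξ) (hξ' : IsBernoulliSeq P' p' ξ')
    (ha : IsSuperdecreasing a) (hp : ∀ i k, 0 < p i k) (hp' : ∀ i k, 0 < p' i k)
    (hu : IsAsymptoticallyUniform p) (hu' : IsAsymptoticallyUniform p') (S : Set ℝ) :
    PreservesHBDim (cdf (P.map (incompleteSum a ξ))) (P'.map (incompleteSum a ξ')) S := by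
  have := hξ.isProbabilityMeasure_map a
  intro E _
  rw [measure_cdf]
  exact (hξ.hbDim_map_le hξ' ha hp hp' hu hu' E).antisymm
    (hξ'.hbDim_map_le hξ ha hp' hp hu' hu E)

end Entropy

section UpperBound

variable {Ω Ω' : Type*} [MeasurableSpace Ω] [MeasurableSpace Ω'] {P : Measure Ω} {P' : Measure Ω'}
  {a : ℕ → ℝ} {p : Fin 2 → ℕ → ℝ} {ξ : ℕ → Ω → Fin 2} {ξ' : ℕ → Ω' → Fin 2}

lemma mul_log_sq_le {x : ℝ} (hx : 0 < x) (hx1 : x ≤ 1) : x * Real.log x ^ 2 ≤ 4 := by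
  have h := Real.abs_log_mul_self_rpow_lt x (1 / 2) hx hx1 one_half_pos
  calc x * Real.log x ^ 2 = |Real.log x * x ^ (1 / 2 : ℝ)| ^ 2 := by
        rw [sq_abs, mul_pow, ← Real.sqrt_eq_rpow, Real.sq_sqrt hx.le, mul_comm]
    _ ≤ (1 / (1 / 2)) ^ 2 := by gcongr
    _ = 4 := by norm_num

lemma IsBernoulliSeq.integral_comp (hξ : IsBernoulliSeq P p ξ) (hp : ∀ i k, 0 ≤ p i k) (k : ℕ)
    (f : Fin 2 → ℝ) : ∫ ω, f (ξ k ω) ∂P = p 0 k * f 0 + p 1 k * f 1 := by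
  have := hξ.isProbabilityMeasure
  have := Measure.isProbabilityMeasure_map (μ := P) (hξ.measurable k).aemeasurable
  have hreal (i : Fin 2) : (P.map (ξ k)).real {i} = p i k := by
    rw [map_measureReal_apply (hξ.measurable k) (measurableSet_singleton i), measureReal_def]
    exact (congrArg ENNReal.toReal (hξ.prob i k)).trans (ENNReal.toReal_ofReal (hp i k))
  rw [← integral_map (hξ.measurable k).aemeasurable (measurable_of_finite f).aestronglyMeasurable,
    integral_fintype .of_finite, Fin.sum_univ_two, hreal, hreal, smul_eq_mul, smul_eq_mul]

lemma IsBernoulliSeq.integral_log (hξ : IsBernoulliSeq P p ξ) (hp : ∀ i k, 0 ≤ p i k) (k : ℕ) :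
    ∫ ω, Real.log (p (ξ k ω) k) ∂P = -digitEntropy p k := by
  rw [hξ.integral_comp hp k fun i => Real.log (p i k), digitEntropy, neg_neg]

lemma IsBernoulliSeq.variance_log_le (hξ : IsBernoulliSeq P p ξ)
    (hsum : ∀ k, p 0 k + p 1 k = 1) (hp : ∀ i k, 0 < p i k) (k : ℕ) :
    variance (fun ω => Real.log (p (ξ k ω) k)) P ≤ 8 := by
  have := hξ.isProbabilityMeasure
  have hmeas : Measurable fun ω => Real.log (p (ξ k ω) k) :=
    (measurable_of_finite fun i => Real.log (p i k)).comp (hξ.measurable k)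
  calc variance (fun ω => Real.log (p (ξ k ω) k)) P ≤ ∫ ω, Real.log (p (ξ k ω) k) ^ 2 ∂P :=
        variance_le_expectation_sq hmeas.aestronglyMeasurable
    _ = p 0 k * Real.log (p 0 k) ^ 2 + p 1 k * Real.log (p 1 k) ^ 2 :=
        hξ.integral_comp (fun i k => (hp i k).le) k fun i => Real.log (p i k) ^ 2
    _ ≤ 4 + 4 := by
        gcongr
        · exact mul_log_sq_le (hp 0 k) (by linarith [hsum k, hp 1 k])
        · exact mul_log_sq_le (hp 1 k) (by linarith [hsum k, hp 0 k])
    _ = 8 := by norm_num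

lemma IsBernoulliSeq.measure_abs_log_cylinderProb_add_le (hξ : IsBernoulliSeq P p ξ)
    (hsum : ∀ k, p 0 k + p 1 k = 1) (hp : ∀ i k, 0 < p i k) {c : ℝ} (hc : 0 < c) (n : ℕ) :
    P {ω | c ≤ |Real.log (cylinderProb p fun k : Fin n => ξ k ω) + entropySum p n|} ≤
      ENNReal.ofReal (8 * n / c ^ 2) := by
  have := hξ.isProbabilityMeasure
  set X : ℕ → Ω → ℝ := fun k ω => Real.log (p (ξ k ω) k)
  have hlog (ω : Ω) : Real.log (cylinderProb p fun k : Fin n => ξ k ω) =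
      (∑ k ∈ Finset.range n, X k) ω := by
    rw [log_cylinderProb hp, Finset.sum_apply, ← Fin.sum_univ_eq_sum_range fun k => X k ω]
  have hX (k : ℕ) : MemLp (X k) 2 P :=
    have := Measure.isProbabilityMeasure_map (μ := P) (hξ.measurable k).aemeasurable
    (MemLp.of_discrete (f := fun i => Real.log (p i k))).comp_measurePreserving
      ((hξ.measurable k).measurePreserving P)
  have hindep : iIndepFun X P :=
    hξ.indep.comp (fun k i => Real.log (p i k)) fun k => measurable_of_finite _
  have hvar : variance (∑ k ∈ Finset.range n, X k) P ≤ 8 * n := by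
    rw [IndepFun.variance_sum (fun k _ => hX k) fun i _ j _ hij => hindep.indepFun hij]
    simpa [mul_comm] using
      Finset.sum_le_card_nsmul (Finset.range n) _ _ fun k _ => hξ.variance_log_le hsum hp k
  have hmean : ∫ ω, (∑ k ∈ Finset.range n, X k) ω ∂P = -entropySum p n := by
    simp only [Finset.sum_apply]
    rw [integral_finsetSum _ fun k _ => (hX k).integrable one_le_two, entropySum,
      ← Finset.sum_neg_distrib]
    exact Finset.sum_congr rfl fun k _ => hξ.integral_log (fun i k => (hp i k).le) k
  have hchebyshev := meas_ge_le_variance_div_sq (memLp_finsetSum' (Finset.range n) fun k _ => hX k)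
    hc
  rw [hmean] at hchebyshev
  simp only [sub_neg_eq_add, ← hlog] at hchebyshev
  exact hchebyshev.trans (ENNReal.ofReal_le_ofReal (by gcongr))

lemma ae_frequently_mem_of_frequently_measure_compl_le {A : ℕ → Set Ω}
    (h : ∀ ε > 0, ∃ᶠ n in atTop, P (A n)ᶜ ≤ ε) : ∀ᵐ ω ∂P, ∃ᶠ n in atTop, ω ∈ A n := by
  simp only [frequently_atTop, ae_all_iff] at h ⊢
  intro N
  refine le_antisymm (le_of_forall_pos_le_add fun ε hε => ?_) zero_le
  obtain ⟨n, hn, hle⟩ := h ε hε N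
  rw [zero_add]
  exact (measure_mono fun ω (hω : ¬ ∃ b ≥ N, ω ∈ A b) hmem => hω ⟨n, hn, hmem⟩).trans hle

lemma IsBernoulliSeq.tendsto_measure_mul_le_abs_log_cylinderProb_add (hξ : IsBernoulliSeq P p ξ)
    (hsum : ∀ k, p 0 k + p 1 k = 1) (hp : ∀ i k, 0 < p i k) {δ : ℝ} (hδ : 0 < δ) :
    Tendsto (fun n : ℕ => P {ω | δ * n ≤
      |Real.log (cylinderProb p fun k : Fin n => ξ k ω) + entropySum p n|}) atTop (nhds 0) := by
  have hlim : Tendsto (fun n : ℕ => ENNReal.ofReal (8 / δ ^ 2 * (n : ℝ)⁻¹)) atTop (nhds 0) := by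
    simpa using ENNReal.tendsto_ofReal
      ((tendsto_inv_atTop_nhds_zero_nat (𝕜 := ℝ)).const_mul (8 / δ ^ 2))
  refine tendsto_of_tendsto_of_tendsto_of_le_of_le' tendsto_const_nhds hlim
    (.of_forall fun _ => zero_le) ?_
  filter_upwards [eventually_gt_atTop 0] with n hn
  refine (hξ.measure_abs_log_cylinderProb_add_le hsum hp (by positivity) n).trans_eq ?_
  congr 1
  field_simp

/-- By Chebyshev's inequality; the ranks at which the entropy ratio is close to its lower limit are
the ones to use. -/
lemma IsBernoulliSeq.ae_frequently_le_cylinderProb (hξ : IsBernoulliSeq P p ξ)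
    (hsum : ∀ k, p 0 k + p 1 k = 1) (hp : ∀ i k, 0 < p i k) {s : ℝ}
    (hs : liminf (entropyRatio p) atTop < s) :
    ∀ᵐ ω ∂P, ∃ᶠ n : ℕ in atTop,
      (2 : ℝ) ^ (-(s * n)) ≤ cylinderProb p fun k : Fin n => ξ k ω := by
  obtain ⟨t, hLt, hts⟩ := exists_between hs
  have hbdd : IsBoundedUnder (· ≤ ·) atTop (entropyRatio p) :=
    isBoundedUnder_of ⟨1, entropyRatio_le_one hsum⟩
  have hfreq : ∃ᶠ n in atTop, entropyRatio p n < t :=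
    frequently_lt_of_liminf_lt hbdd.isCoboundedUnder_ge hLt
  have hδ : 0 < (s - t) * Real.log 2 := mul_pos (sub_pos.mpr hts) (Real.log_pos one_lt_two)
  have hlim := hξ.tendsto_measure_mul_le_abs_log_cylinderProb_add hsum hp hδ
  refine ae_frequently_mem_of_frequently_measure_compl_le
    (A := fun n => {ω | (2 : ℝ) ^ (-(s * n)) ≤ cylinderProb p fun k : Fin n => ξ k ω})
    fun ε hε => (hfreq.and_eventually (hlim.eventually_le_const hε)).mono ?_
  rintro n ⟨hratio, hle⟩
  refine (measure_mono fun ω hω => ?_).trans hle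
  have hlog : Real.log (cylinderProb p fun k : Fin n => ξ k ω) < -(s * n) * Real.log 2 := by
    rw [← Real.log_rpow two_pos]
    exact Real.log_lt_log (cylinderProb_pos hp _) (not_le.mp hω)
  have hentropy : entropySum p n ≤ t * (n * Real.log 2) := by
    rw [← entropyRatio_mul]
    gcongr
  have hdeviation : (s - t) * Real.log 2 * n ≤
      -(Real.log (cylinderProb p fun k : Fin n => ξ k ω) + entropySum p n) := by linarith
  exact hdeviation.trans (neg_le_abs _)

/-- The words of rank `n` whose cylinders have a probability of at least `2 ^ (-s * n)`. -/
noncomputable def heavyWords (p : Fin 2 → ℕ → ℝ) (s : ℝ) (n : ℕ) : Finset (Fin n → Fin 2) :=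
  {w | (2 : ℝ) ^ (-(s * n)) ≤ cylinderProb p w}

lemma sum_heavyWords_rpow_le (hsum : ∀ k, p 0 k + p 1 k = 1) (hp : ∀ i k, 0 ≤ p i k) (α s : ℝ)
    (n : ℕ) : ∑ _w ∈ heavyWords p s n, ((1 / 2 : ℝ) ^ n) ^ α ≤ ((2 : ℝ) ^ (s - α)) ^ n := by
  have hsplit : ((1 / 2 : ℝ) ^ n) ^ α = ((2 : ℝ) ^ (s - α)) ^ n * (2 : ℝ) ^ (-(s * n)) := by
    rw [one_div, inv_pow, ← Real.rpow_natCast, ← Real.rpow_neg two_pos.le,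
      ← Real.rpow_mul two_pos.le, ← Real.rpow_mul_natCast two_pos.le, ← Real.rpow_add two_pos]
    ring_nf
  calc ∑ _w ∈ heavyWords p s n, ((1 / 2 : ℝ) ^ n) ^ α
      ≤ ∑ w ∈ heavyWords p s n, ((2 : ℝ) ^ (s - α)) ^ n * cylinderProb p w := by
        refine Finset.sum_le_sum fun w hw => ?_
        rw [hsplit]
        gcongr
        exact (Finset.mem_filter.mp hw).2
    _ ≤ ∑ w : Fin n → Fin 2, ((2 : ℝ) ^ (s - α)) ^ n * cylinderProb p w :=
        Finset.sum_le_univ_sum_of_nonneg fun w =>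
          mul_nonneg (by positivity) (cylinderProb_nonneg hp w)
    _ = ((2 : ℝ) ^ (s - α)) ^ n := by rw [← Finset.mul_sum, sum_cylinderProb hsum, mul_one]

lemma IsBernoulliSeq.tsum_heavyWords_ne_top {p' : Fin 2 → ℕ → ℝ} (hξ' : IsBernoulliSeq P' p' ξ')
    (ha : IsSuperdecreasing a) (hp' : ∀ i k, p' i k = 1 / 2) (hsum : ∀ k, p 0 k + p 1 k = 1)
    (hp : ∀ i k, 0 ≤ p i k) {α : ℝ≥0} {s : ℝ} (hs : s < α) :
    ∑' i : Σ n, heavyWords p s n,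
      P'.map (incompleteSum a ξ') (cylinderHull a i.2.1) ^ (α : ℝ) ≠ ⊤ := by
  have hmap {n : ℕ} (w : Fin n → Fin 2) :
      P'.map (incompleteSum a ξ') (cylinderHull a w) ^ (α : ℝ) =
        ENNReal.ofReal (((1 / 2 : ℝ) ^ n) ^ (α : ℝ)) := by
    rw [hξ'.map_cylinderHull ha (by simp [hp']), ENNReal.ofReal_rpow_of_nonneg
      (cylinderProb_nonneg (by simp [hp']) w) α.coe_nonneg]
    simp [cylinderProb, hp']
  have hgeom : Summable fun n : ℕ => ((2 : ℝ) ^ (s - α)) ^ n :=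
    summable_geometric_of_lt_one (by positivity)
      (Real.rpow_lt_one_of_one_lt_of_neg one_lt_two (sub_neg.mpr hs))
  refine ne_top_of_le_ne_top hgeom.tsum_ofReal_ne_top ?_
  rw [ENNReal.tsum_sigma']
  refine ENNReal.tsum_le_tsum fun n => ?_
  simp only [hmap, tsum_fintype, Finset.sum_coe_sort (heavyWords p s n) fun _ =>
    ENNReal.ofReal (((1 / 2 : ℝ) ^ n) ^ (α : ℝ))]
  rw [← ENNReal.ofReal_sum_of_nonneg fun _ _ => by positivity]
  exact ENNReal.ofReal_le_ofReal (sum_heavyWords_rpow_le hsum hp α s n)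

lemma frequently_cofinite_sigma {β : ℕ → Type*} {r : (Σ n, β n) → Prop}
    (h : ∃ᶠ n in atTop, ∃ b, r ⟨n, b⟩) : ∃ᶠ i in cofinite, r i := by
  rw [Nat.frequently_atTop_iff_infinite] at h
  rw [frequently_cofinite_iff_infinite]
  refine .of_image Sigma.fst (h.mono ?_)
  rintro n ⟨b, hb⟩
  exact ⟨⟨n, b⟩, hb, rfl⟩

lemma IsBernoulliSeq.hbDimMeasure_le {p' : Fin 2 → ℕ → ℝ} (hξ : IsBernoulliSeq P p ξ)
    (hξ' : IsBernoulliSeq P' p' ξ') (ha : IsSuperdecreasing a) (hsum : ∀ k, p 0 k + p 1 k = 1)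
    (hp : ∀ i k, 0 < p i k) (hp' : ∀ i k, p' i k = 1 / 2) :
    hbDimMeasure (P.map (incompleteSum a ξ)) (P'.map (incompleteSum a ξ')) ≤
      ENNReal.ofReal (liminf (entropyRatio p) atTop) := by
  have := hξ.isProbabilityMeasure_map a
  refine ENNReal.le_of_forall_pos_le_add fun ε hε _ => ?_
  set α : ℝ≥0 := (liminf (entropyRatio p) atTop).toNNReal + ε
  have hα : 0 < α := by positivity
  have hlt : liminf (entropyRatio p) atTop < α :=
    (Real.le_coe_toNNReal _).trans_lt (mod_cast lt_add_of_pos_right _ hε)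
  obtain ⟨s, hLs, hsα⟩ := exists_between hlt
  have hheavy : ∀ᵐ t ∂P.map (incompleteSum a ξ),
      ∃ᶠ n in atTop, ∃ w : heavyWords p s n, t ∈ cylinderHull a w.1 := by
    rw [ae_map_iff (hξ.measurable_incompleteSum a).aemeasurable]
    · filter_upwards [hξ.ae_frequently_le_cylinderProb hsum hp hLs] with ω hω
      exact hω.mono fun n hn => ⟨⟨_, Finset.mem_filter.mpr ⟨Finset.mem_univ _, hn⟩⟩,
        incompleteSum_mem_cylinderHull ha.summable ξ ω n⟩
    · simp only [frequently_atTop, cylinderHull]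
      measurability
  have hzero := hbMeasure_setOf_frequently_mem_Icc hα
    (hξ'.tsum_heavyWords_ne_top ha hp' hsum (fun i k => (hp i k).le) hsα)
  calc _ ≤ hbDim (P'.map (incompleteSum a ξ')) _ :=
        hbDimMeasure_le_hbDim _ (hheavy.mono fun t ht => frequently_cofinite_sigma ht)
    _ ≤ α := hbDim_le_of_hbMeasure_eq_zero hα hzero
    _ = _ := by simp [α, ENNReal.ofReal]

end UpperBound

theorem mainTheorem5_general
    {Ω Ω' : Type*} [MeasurableSpace Ω] [MeasurableSpace Ω'] (P : Measure Ω) (P' : Measure Ω')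
    (a : ℕ → ℝ) (ha : IsSuperdecreasing a)
    (p : Fin 2 → ℕ → ℝ) (hsum : ∀ k, p 0 k + p 1 k = 1)
    (hp : ∃ p₀ : ℝ, 0 < p₀ ∧ ∀ i k, p₀ < p i k)
    (ξ : ℕ → Ω → Fin 2) (hξ : IsBernoulliSeq P p ξ)
    (ξ' : ℕ → Ω' → Fin 2) (hξ' : IsBernoulliSeq P' (uniformProb p) ξ')
    (μ ν : Measure ℝ) (hμ : μ = P.map (incompleteSum a ξ))
    (hν : ν = P'.map (incompleteSum a ξ')) :
    (PreservesHBDim (cdf μ) ν μ.support ↔ hbDimMeasure μ ν = 1) ∧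
      (hbDimMeasure μ ν = 1 ↔
        liminf (fun n : ℕ => entropySum p n / ((positiveEntropyCount p n : ℝ) * Real.log 2))
          atTop = 1) := by
  obtain ⟨p₀, hp₀, hp⟩ := hp
  have hpos (i : Fin 2) (k : ℕ) : 0 < p i k := hp₀.trans (hp i k)
  have hhalf := uniformProb_eq_half hsum hpos
  have hliminf := liminf_entropyRatio_le_one hsum hpos
  have hdim := hξ.hbDimMeasure_le hξ' ha hsum hpos hhalf
  have : IsProbabilityMeasure μ := hμ ▸ hξ.isProbabilityMeasure_map a
  rw [← hμ, ← hν] at hdim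
  have htfae : [PreservesHBDim (cdf μ) ν μ.support, hbDimMeasure μ ν = 1,
      liminf (entropyRatio p) atTop = 1].TFAE := by
    tfae_have 1 → 2 := fun h => (hdim.trans (ENNReal.ofReal_le_one.mpr hliminf)).antisymm
      (one_le_hbDimMeasure_of_preservesHBDim h)
    tfae_have 2 → 3 := fun h => hliminf.antisymm (ENNReal.one_le_ofReal.mp (h ▸ hdim))
    tfae_have 3 → 1 := fun h => by
      have hu := isAsymptoticallyUniform_of_tendsto hsum hp₀ (fun i k => (hp i k).le)
        (tendsto_entropyRatio_of_liminf_eq_one hsum hpos h)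
      rw [hμ, hν]
      exact hξ.preservesHBDim hξ' ha hpos (by simp [hhalf]) hu
        (isAsymptoticallyUniform_of_eq_half hhalf) _
    tfae_finish
  simp only [positiveEntropyCount_eq (digitEntropy_pos hsum hpos)]
  exact ⟨htfae.out 0 1, htfae.out 1 2⟩

theorem mainTheorem5
    {Ω Ω' : Type*} [MeasurableSpace Ω] [MeasurableSpace Ω']
    (P : Measure Ω) [IsProbabilityMeasure P] (P' : Measure Ω') [IsProbabilityMeasure P']
    (q : ℕ → ℕ) (hq : IsSecondOstrogradsky q)
    (p : Fin 2 → ℕ → ℝ) (hsum : ∀ k, p 0 k + p 1 k = 1)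
    (hp : ∃ p₀ : ℝ, 0 < p₀ ∧ ∀ i k, p₀ < p i k)
    (ξ : ℕ → Ω → Fin 2) (hξ : IsBernoulliSeq P p ξ)
    (ξ' : ℕ → Ω' → Fin 2) (hξ' : IsBernoulliSeq P' (uniformProb p) ξ')
    (μ ν : Measure ℝ) (hμ : μ = P.map (ostrogradskySum q ξ))
    (hν : ν = P'.map (ostrogradskySum q ξ')) :
    (PreservesHBDim (cdf μ) ν μ.support ↔ hbDimMeasure μ ν = 1) ∧
      (hbDimMeasure μ ν = 1 ↔
        liminf (fun n : ℕ => entropySum p n / ((positiveEntropyCount p n : ℝ) * Real.log 2))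
          atTop = 1) := by
  rw [ostrogradskySum_eq_incompleteSum] at hμ hν
  exact mainTheorem5_general P P' _ hq.isSuperdecreasing p hsum hp ξ hξ ξ' hξ' μ ν hμ hν
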